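/- Let $d\in\{2,3\}$, let $\Omega\subset\mathbb R^d$ be a bounded Lipschitz domain, let $\mathcal T$ be a regular triangulation of $\Omega$ into simplices with set of faces $\mathcal F$ and $h=\max_{T\in\mathcal T}\operatorname{diam}T$, let $k\ge 1$ be an integer, and let $\nu,\alpha,c_M,M>0$. Write $(\cdot,\cdot)_\omega$ for the $L^2$ inner product on $\omega$, $(\cdot,\cdot)=(\cdot,\cdot)_\Omega$, $n$ for the outward unit normal on $\partial T$, $n_F$ for a unit normal of $F\in\mathcal F$, and $v_t=v-(v\cdot n)n$. Put $$V_h=[P_k(\mathcal T)]^d\cap H_0(\mathrm{div},\Omega),\qquad Q_h=P_{k-1}(\mathcal T),$$ $$\widehat V_h=\{\hat v_h\in [L^2(\mathcal F)]^d:\ \hat v_h|_F\in [P_k(F)]^d,\ \hat v_h\cdot n_F=0\ \ \forall F\in\mathcal F,\ \hat v_h=0\text{ on }\partial\Omega\},$$ where $H_0(\mathrm{div},\Omega)$ is the closure of $C_c^\infty(\Omega)^d$ in $H(\mathrm{div},\Omega)$ (equivalently, the fields with vanishing normal trace). For $g\in L^\infty(\Omega)^d$ and $f\in L^2(\Omega)^d$,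 the $H(\mathrm{div})$-conforming HDG scheme seeks $u_h\in V_h$, $\hat u_h\in\widehat V_h$, $\varrho_h\in Q_h$ such that, for all $v_h\in V_h$, $\hat v_h\in\widehat V_h$, $\lambda_h\in Q_h$, $$a_h((u_h,\hat u_h),(v_h,\hat v_h))-(c_M\varrho_h,\operatorname{div}v_h)=(f,v_h)+(g,\varrho_hv_h),\qquad c_h(\varrho_h,u_h,\lambda_h)=0,\qquad (\varrho_h,1)=M,$$ with $$a_h((u,\hat u),(v,\hat v))=\nu\sum_{T\in\mathcal T}\Big[(\nabla u,\nabla v)_T+(\nabla u\,n,(\hat v-v)_t)_{\partial T}+(\nabla v\,n,(\hat u-u)_t)_{\partial T}+\tfrac{\alpha k^2}{h}((\hat u-u)_t,(\hat v-v)_t)_{\partial T}\Big],$$ $$c_h(\varrho,u,\lambda)=\sum_{T\in\mathcal T}\Big[-(\varrho u,\nabla\lambda)_T+(u\cdot n\,\varrho^{up},\lambda)_{\partial T}\Big],$$ where $\varrho^{up}$ is the upwind value: on a face of $T$ it is the trace of $\varrho$ from $T$ where $u\cdot n\ge 0$ and the trace from the neighboring element where $u\cdot n<0$. A force $f\in L^2(\Omega)^d$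 is an admissible gradient force if $f=\nabla q$ (weakly) for some $q\in H^1(\Omega)$ for which there is a constant $C$ with $(q-C)/c_M\ge 0$ a.e. in $\Omega$ and $((q-C)/c_M,1)=M$. The scheme is gradient-robust if, whenever $g=0$ and $f$ is an admissible gradient force, it has a solution with $u_h=0$ and $\hat u_h=0$. Then the scheme is gradient-robust. More precisely, if $g=0$ and $f=\nabla q$ is an admissible gradient force with potential $q$, then $$u_h=0,\qquad \hat u_h=0,\qquad \varrho_h=\frac{1}{c_M}\Pi_{Q_h}q+\kappa,\qquad \kappa=\frac{1}{|\Omega|}\Big(M-\frac1{c_M}\int_\Omega q\,dx\Big),$$ solves the scheme, where $\Pi_{Q_h}$ is the $L^2(\Omega)$-orthogonal projection onto $Q_h$. If $k=1$, then moreover $\varrho_h\ge 0$, and $\varrho_h>0$ if $q/c_M+\kappa>0$ a.e. in $\Omega$. -/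

import Mathlib

open MeasureTheory Filter Topology
open scoped ContDiff ENNReal

noncomputable section

namespace CompressibleStokes

/-- The space `ℝ^d` with its Euclidean norm. -/
abbrev Rd (d : ℕ) : Type := EuclideanSpace ℝ (Fin d)

variable {d : ℕ}

/-! ### Lipschitz domains -/

/-- A bounded Lipschitz domain: nonempty, open, connected, bounded, and near each boundary point,
in suitable orthonormal coordinates (with "vertical" direction `e`), the set of points strictly
above the graph of a Lipschitz function of the remaining `d - 1` coordinates. -/
structure IsLipschitzDomain (Ω : Set (Rd d)) : Prop where
  isOpen : IsOpen Ω
  isConnected : IsConnected Ω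
  isBounded : Bornology.IsBounded Ω
  lipschitz_boundary : ∀ x₀ ∈ frontier Ω, ∃ e : Rd d, ‖e‖ = 1 ∧
    ∃ (L : NNReal) (γ : (Submodule.span ℝ {e})ᗮ → ℝ), LipschitzWith L γ ∧
      ∃ U ∈ 𝓝 x₀, ∀ x ∈ U,
        (x ∈ Ω ↔ γ ((Submodule.span ℝ {e})ᗮ.orthogonalProjectionOnto x) < inner ℝ e x)

/-! ### Weak derivatives, `H¹(Ω)` and `H₀(div, Ω)` -/

/-- Lebesgue measure on `Ω`. -/
abbrev vol (Ω : Set (Rd d)) : Measure (Rd d) := volume.restrict Ω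

/-- `C_c^∞(Ω; G)`. -/
structure IsTestFunction {G : Type*} [NormedAddCommGroup G] [NormedSpace ℝ G]
    (Ω : Set (Rd d)) (φ : Rd d → G) : Prop where
  smooth : ContDiff ℝ ∞ φ
  compact : HasCompactSupport φ
  support_subset : tsupport φ ⊆ Ω

/-- The classical partial derivative `∂_i φ`. -/
def partialDeriv (i : Fin d) (φ : Rd d → ℝ) (x : Rd d) : ℝ :=
  fderiv ℝ φ x (EuclideanSpace.single i 1)

/-- The classical divergence of a vector field. -/
def classicalDiv (φ : Rd d → Rd d) (x : Rd d) : ℝ :=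
  ∑ i, partialDeriv i (fun y => φ y i) x

/-- `q ∈ H¹(Ω)` with weak gradient `f`. -/
structure IsH1WithGradient (Ω : Set (Rd d)) (q : Rd d → ℝ) (f : Rd d → Rd d) : Prop where
  memLp : MemLp q 2 (vol Ω)
  memLp_gradient : MemLp f 2 (vol Ω)
  weak : ∀ φ : Rd d → ℝ, IsTestFunction Ω φ → ∀ i,
    ∫ x in Ω, q x * partialDeriv i φ x = -∫ x in Ω, f x i * φ x

/-- `w ∈ L²(Ω)` is the weak divergence of `v` on `Ω`. -/
structure HasWeakDiv (Ω : Set (Rd d)) (v : Rd d → Rd d) (w : Rd d → ℝ) : Prop where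
  memLp : MemLp w 2 (vol Ω)
  weak : ∀ φ : Rd d → ℝ, IsTestFunction Ω φ →
    ∫ x in Ω, w x * φ x = -∫ x in Ω, ∑ i, v x i * partialDeriv i φ x

/-- `v ∈ H(div, Ω)`. -/
def MemHdiv (Ω : Set (Rd d)) (v : Rd d → Rd d) : Prop :=
  MemLp v 2 (vol Ω) ∧ ∃ w, HasWeakDiv Ω v w

open Classical in
/-- The weak divergence of `v ∈ H(div, Ω)`, an element of `L²(Ω)` (unique up to null sets). -/
def weakDiv (Ω : Set (Rd d)) (v : Rd d → Rd d) : Rd d → ℝ :=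
  if h : ∃ w, HasWeakDiv Ω v w then h.choose else 0

/-- `v ∈ H₀(div, Ω)`: the closure of `C_c^∞(Ω)^d` in `H(div, Ω)`. On a Lipschitz domain these are
the fields in `H(div, Ω)` with vanishing normal trace. -/
def MemH0div (Ω : Set (Rd d)) (v : Rd d → Rd d) : Prop :=
  MemHdiv Ω v ∧ ∃ φ : ℕ → Rd d → Rd d, (∀ n, IsTestFunction Ω (φ n)) ∧
    Tendsto (fun n => eLpNorm (fun x => v x - φ n x) 2 (vol Ω)) atTop (𝓝 0) ∧
    Tendsto (fun n => eLpNorm (fun x => weakDiv Ω v x - classicalDiv (φ n) x) 2 (vol Ω))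
      atTop (𝓝 0)

/-! ### Triangulations -/

/-- A regular (conforming) triangulation of `Ω` into `d`-simplices: a finite geometric simplicial
complex, all of whose simplices are faces of `d`-simplices, that covers the closure of `Ω`. -/
structure Triangulation (Ω : Set (Rd d)) where
  complex : Geometry.SimplicialComplex ℝ (Rd d)
  finite : complex.faces.Finite
  pure : ∀ s ∈ complex.faces, ∃ t ∈ complex.faces, s ⊆ t ∧ t.card = d + 1
  space_eq : complex.space = closure Ω

/-- The closed simplex with the given vertices. -/
abbrev hull (s : Finset (Rd d)) : Set (Rd d) := convexHull ℝ (s : Set (Rd d))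

namespace Triangulation

variable {Ω : Set (Rd d)} (𝒯 : Triangulation Ω)

/-- The elements `T` of the triangulation, as vertex sets. -/
def cells : Finset (Finset (Rd d)) := {s ∈ 𝒯.finite.toFinset | s.card = d + 1}

/-- The `(d-1)`-dimensional faces `F` of the triangulation, as vertex sets. -/
def facets : Finset (Finset (Rd d)) := {s ∈ 𝒯.finite.toFinset | s.card = d}

/-- The mesh size `h = max_T diam T`. -/
def meshSize : ℝ := ⨆ T : 𝒯.cells, Metric.diam (hull T.1)

open Classical in
/-- `∫_{∂T} φ ds`, as the sum over the faces `F` of `T` of the surface integrals over `F` of the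
values `φ F` on `F`. -/
def bdryIntegral (T : 𝒯.cells) (φ : 𝒯.facets → Rd d → ℝ) : ℝ :=
  ∑ F : 𝒯.facets with F.1 ⊆ T.1, ∫ x in hull F.1, φ F x ∂(Measure.euclideanHausdorffMeasure (d - 1))

end Triangulation

/-- `n` is a unit normal vector of the face `F`. -/
def IsUnitNormal (F : Finset (Rd d)) (n : Rd d) : Prop :=
  ‖n‖ = 1 ∧ ∀ x ∈ F, ∀ y ∈ F, inner ℝ n (x - y) = 0

/-- The unit normal vector on the face `F` of the simplex `T` that points out of `T`. -/
def outwardNormal (T F : Finset (Rd d)) : Rd d :=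
  Classical.epsilon fun n => IsUnitNormal F n ∧ ∀ x ∈ T, ∀ y ∈ F, inner ℝ n (x - y) ≤ 0

/-- The tangential part `v_t = v - (v · n) n`. -/
def tangential (n v : Rd d) : Rd d := v - (inner ℝ v n : ℝ) • n

/-! ### Piecewise polynomials -/

/-- Real polynomials in `d` variables. -/
abbrev Poly (d : ℕ) : Type := MvPolynomial (Fin d) ℝ

/-- The value of a scalar polynomial at a point. -/
def pval (p : Poly d) (x : Rd d) : ℝ := MvPolynomial.eval (fun i => x i) p

/-- The value of a vector-valued polynomial at a point. -/
def vval (v : Fin d → Poly d) (x : Rd d) : Rd d := WithLp.toLp 2 fun i => pval (v i) x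

/-- The gradient of a scalar polynomial. -/
def pgrad (p : Poly d) (x : Rd d) : Rd d := WithLp.toLp 2 fun j => pval (MvPolynomial.pderiv j p) x

/-- The matrix product `(∇v) n`, where `(∇v)_{ij} = ∂_j v_i`. -/
def gradMul (v : Fin d → Poly d) (n x : Rd d) : Rd d :=
  WithLp.toLp 2 fun i => ∑ j, pval (MvPolynomial.pderiv j (v i)) x * n j

/-- The Frobenius product `∇u : ∇v`. -/
def gradInner (u v : Fin d → Poly d) (x : Rd d) : ℝ :=
  ∑ i, ∑ j, pval (MvPolynomial.pderiv j (u i)) x * pval (MvPolynomial.pderiv j (v i)) x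

namespace Triangulation

variable {Ω : Set (Rd d)} (𝒯 : Triangulation Ω)

/-- A scalar piecewise polynomial: one polynomial on each element (so that `λ T` is both the
restriction to `T` and gives the trace from `T` on `∂T`). -/
abbrev Scalar : Type := 𝒯.cells → Poly d

/-- A vector-valued piecewise polynomial. -/
abbrev Vector : Type := 𝒯.cells → Fin d → Poly d

/-- A vector-valued function on the skeleton that is polynomial on each face; only the values of
the polynomial `v F` on `F` are ever used. -/
abbrev FacetVector : Type := 𝒯.facets → Fin d → Poly d

variable {𝒯}

/-- The function on `Ω` (defined up to the skeleton, a null set) given by a piecewise polynomial. -/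
def Scalar.toFun (r : 𝒯.Scalar) (x : Rd d) : ℝ :=
  ∑ T, (interior (hull T.1)).indicator (pval (r T)) x

/-- The vector field on `Ω` (defined up to a null set) given by a piecewise polynomial. -/
def Vector.toFun (v : 𝒯.Vector) (x : Rd d) : Rd d :=
  ∑ T, (interior (hull T.1)).indicator (vval (v T)) x

variable (𝒯)

/-- The space `P_m(𝒯)` of piecewise polynomials of total degree at most `m`. -/
def scalarSpace (m : ℕ) : Set 𝒯.Scalar := {r | ∀ T, (r T).totalDegree ≤ m}

/-- The density and pressure space `Q_h = P_{k-1}(𝒯)`. -/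
def Qh (k : ℕ) : Set 𝒯.Scalar := 𝒯.scalarSpace (k - 1)

/-- The velocity space `V_h = P_k(𝒯)^d ∩ H₀(div, Ω)`. -/
def Vh (k : ℕ) : Set 𝒯.Vector :=
  {v | (∀ T i, (v T i).totalDegree ≤ k) ∧ MemH0div Ω (Vector.toFun v)}

/-- The hybrid space: polynomials of degree at most `k` on each face, tangential to it, and zero
on the faces in the boundary of `Ω`. -/
def VhHat (k : ℕ) : Set 𝒯.FacetVector :=
  {v | (∀ F i, (v F i).totalDegree ≤ k) ∧
    (∀ F, ∀ n, IsUnitNormal F.1 n → ∀ x ∈ hull F.1, inner ℝ (vval (v F) x) n = 0) ∧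
    (∀ F, hull F.1 ⊆ frontier Ω → ∀ x ∈ hull F.1, vval (v F) x = 0)}

/-- `π` is the `L²(Ω)`-orthogonal projection of `q` onto `Q_h`. -/
def IsL2Projection (k : ℕ) (q : Rd d → ℝ) (π : 𝒯.Scalar) : Prop :=
  π ∈ 𝒯.Qh k ∧ ∀ r ∈ 𝒯.Qh k, ∫ x in Ω, (q x - Scalar.toFun π x) * Scalar.toFun r x = 0

/-! ### The forms of the scheme -/

/-- `(û - u)_t`: the tangential part of `û - u` on the face `F` of `T`. -/
def tangJump (u : 𝒯.Vector) (uhat : 𝒯.FacetVector) (T : 𝒯.cells) (F : 𝒯.facets) (x : Rd d) : Rd d :=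
  tangential (outwardNormal T.1 F.1) (vval (uhat F) x - vval (u T) x)

/-- The diffusion form `a_h((u, û), (v, v̂))`. -/
def aForm (k : ℕ) (ν α : ℝ) (u : 𝒯.Vector) (uhat : 𝒯.FacetVector)
    (v : 𝒯.Vector) (vhat : 𝒯.FacetVector) : ℝ :=
  ν * ∑ T : 𝒯.cells,
    ((∫ x in hull T.1, gradInner (u T) (v T) x)
      + 𝒯.bdryIntegral T (fun F x =>
          inner ℝ (gradMul (u T) (outwardNormal T.1 F.1) x) (𝒯.tangJump v vhat T F x))
      + 𝒯.bdryIntegral T (fun F x =>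
          inner ℝ (gradMul (v T) (outwardNormal T.1 F.1) x) (𝒯.tangJump u uhat T F x))
      + α * (k : ℝ) ^ 2 / 𝒯.meshSize * 𝒯.bdryIntegral T (fun F x =>
          inner ℝ (𝒯.tangJump u uhat T F x) (𝒯.tangJump v vhat T F x)))

/-- The pressure form `-(p(ϱ), div v)` for the equation of state `p(ϱ) = c_M ϱ`. -/
def bForm (cM : ℝ) (r : 𝒯.Scalar) (v : 𝒯.Vector) : ℝ :=
  -∫ x in Ω, (cM * Scalar.toFun r x) * weakDiv Ω (Vector.toFun v) x

open Classical in
/-- The upwind value of `ϱ` on the face `F` of `T`: the value from `T` where the flow leaves `T`,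
and the value from the neighbor of `T` across `F` (the only other element that contains `F`) where
it enters `T`. On boundary faces the normal velocity vanishes and the value is irrelevant. -/
def upwind (r : 𝒯.Scalar) (u : 𝒯.Vector) (T : 𝒯.cells) (F : 𝒯.facets) (x : Rd d) : ℝ :=
  if 0 ≤ (inner ℝ (vval (u T) x) (outwardNormal T.1 F.1) : ℝ) then pval (r T) x
  else ∑ T' : 𝒯.cells with T' ≠ T ∧ F.1 ⊆ T'.1, pval (r T') x

/-- The transport form `c_h(ϱ, u, λ)`. -/
def cForm (r : 𝒯.Scalar) (u : 𝒯.Vector) (l : 𝒯.Scalar) : ℝ :=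
  ∑ T : 𝒯.cells,
    (-(∫ x in hull T.1, pval (r T) x * inner ℝ (vval (u T) x) (pgrad (l T) x))
      + 𝒯.bdryIntegral T (fun F x =>
          inner ℝ (vval (u T) x) (outwardNormal T.1 F.1) * 𝒯.upwind r u T F x * pval (l T) x))

/-- The force term `F_h(v) = (f, v)`. -/
def fForm (f : Rd d → Rd d) (v : 𝒯.Vector) : ℝ :=
  ∫ x in Ω, inner ℝ (f x) (Vector.toFun v x)

/-- The gravity term `G_h(ϱ, v) = (g, ϱ v)`. -/
def gForm (g : Rd d → Rd d) (r : 𝒯.Scalar) (v : 𝒯.Vector) : ℝ :=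
  ∫ x in Ω, inner ℝ (g x) (Scalar.toFun r x • Vector.toFun v x)

/-- `(u, û, ϱ)` solves the `H(div)`-conforming HDG scheme with data `g`, `f` and mass `M`. -/
structure IsDiscreteSolution (k : ℕ) (ν α cM M : ℝ) (g f : Rd d → Rd d)
    (u : 𝒯.Vector) (uhat : 𝒯.FacetVector) (r : 𝒯.Scalar) : Prop where
  velocity_mem : u ∈ 𝒯.Vh k
  hybrid_mem : uhat ∈ 𝒯.VhHat k
  density_mem : r ∈ 𝒯.Qh k
  momentum : ∀ v ∈ 𝒯.Vh k, ∀ vhat ∈ 𝒯.VhHat k,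
    𝒯.aForm k ν α u uhat v vhat + 𝒯.bForm cM r v = 𝒯.fForm f v + 𝒯.gForm g r v
  continuity : ∀ l ∈ 𝒯.Qh k, 𝒯.cForm r u l = 0
  mass : ∫ x in Ω, Scalar.toFun r x = M

end Triangulation

/-! ### Gradient-robustness -/

/-- The potential `q` is admissible: for some constant `C` the density `(q - C) / c_M` is
non-negative and has mass `M`. -/
def IsAdmissiblePotential (Ω : Set (Rd d)) (cM M : ℝ) (q : Rd d → ℝ) : Prop :=
  ∃ C : ℝ, (∀ᵐ x ∂(vol Ω), 0 ≤ (q x - C) / cM) ∧ ∫ x in Ω, (q x - C) / cM = M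

/-- `f` is an admissible gradient force. -/
def IsAdmissibleGradientForce (Ω : Set (Rd d)) (cM M : ℝ) (f : Rd d → Rd d) : Prop :=
  ∃ q, IsH1WithGradient Ω q f ∧ IsAdmissiblePotential Ω cM M q

/-- The scheme is gradient-robust: it has a hydrostatic solution (vanishing velocity) whenever
`g = 0` and `f` is an admissible gradient force. -/
def Triangulation.GradientRobust {Ω : Set (Rd d)} (𝒯 : Triangulation Ω) (k : ℕ)
    (ν α cM M : ℝ) : Prop :=
  ∀ f : Rd d → Rd d, IsAdmissibleGradientForce Ω cM M f →
    ∃ r : 𝒯.Scalar, 𝒯.IsDiscreteSolution k ν α cM M 0 f 0 0 r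

/-- The piecewise polynomial `π / c_M + κ`. -/
def Triangulation.hydrostaticDensity {Ω : Set (Rd d)} {𝒯 : Triangulation Ω} (cM κ : ℝ)
    (π : 𝒯.Scalar) : 𝒯.Scalar :=
  fun T => MvPolynomial.C cM⁻¹ * π T + MvPolynomial.C κ

end CompressibleStokes

end

/-! At zero velocity the diffusion and transport forms vanish, and so does the gravity term for `g =
0`. The scheme then reduces to the mass constraint and the balance `-(c_M ϱ, div v) = (∇q, v)` for
all `v ∈ V_h`. Since `v` is an `H(div)` limit of test fields, `(∇q, v) = -(q, div v)`
(`IsH1WithGradient.setIntegral_inner`). Since `div v` lies in `Q_h` (`Vector.div_mem_Qh`), `q` may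
be replaced by its projection. Since `div v` has mean zero (`MemH0div.setIntegral_weakDiv`), a
constant may be added to the density. Hence `ϱ = Π q / c_M + κ` balances the force exactly, and the
mass fixes `κ`. The weak divergence must be identified with the piecewise one
(`weakDiv_toFun_ae_eq`); this needs cell interiors that are disjoint, lie in `Ω` and cover it up to
a null set. For `k = 1` the density on a cell is the mean of `q / c_M + κ`. The constant `C` of an
admissible potential is forced by the mass to satisfy `κ = -C / c_M`, so these means are
nonnegative. -/

namespace CompressibleStokes

variable {d : ℕ}

/-! ### Polynomials -/

theorem contDiff_pval (p : Poly d) : ContDiff ℝ ∞ (pval p) := by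
  induction p using MvPolynomial.induction_on with
  | C a =>
    have : pval (MvPolynomial.C a : Poly d) = fun _ => a := by ext x; simp [pval]
    rw [this]; exact contDiff_const
  | add p q hp hq =>
    have : pval (p + q) = fun x => pval p x + pval q x := by ext x; simp [pval]
    rw [this]; exact hp.add hq
  | mul_X p i hp =>
    have : pval (p * MvPolynomial.X i) = fun x => pval p x * x i := by ext x; simp [pval]
    rw [this]; exact hp.mul (by fun_prop)

theorem continuous_pval (p : Poly d) : Continuous (pval p) := (contDiff_pval p).continuous

theorem differentiable_pval (p : Poly d) : Differentiable ℝ (pval p) :=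
  (contDiff_pval p).differentiable (by simp)

theorem partialDeriv_pval (i : Fin d) (p : Poly d) (x : Rd d) :
    partialDeriv i (pval p) x = pval (MvPolynomial.pderiv i p) x := by
  unfold partialDeriv
  induction p using MvPolynomial.induction_on with
  | C a =>
    have : pval (MvPolynomial.C a : Poly d) = fun _ => a := by ext x; simp [pval]
    simp [this, pval]
  | add p q hp hq =>
    have : pval (p + q) = fun x => pval p x + pval q x := by ext x; simp [pval]
    rw [this, fderiv_fun_add (differentiable_pval p x) (differentiable_pval q x)]
    simp only [add_apply, hp, hq]
    simp [pval]
  | mul_X p j hp =>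
    have : pval (p * MvPolynomial.X j) = fun x => pval p x * x j := by ext x; simp [pval]
    have hj : HasFDerivAt (fun y : Rd d => y j) (EuclideanSpace.proj j : Rd d →L[ℝ] ℝ) x :=
      (EuclideanSpace.proj j : Rd d →L[ℝ] ℝ).hasFDerivAt
    rw [this, ((differentiable_pval p x).hasFDerivAt.fun_mul hj).fderiv]
    simp only [add_apply, smul_apply, hp, smul_eq_mul, Derivation.leibniz, MvPolynomial.pderiv_X]
    by_cases h : j = i
    · subst h; simp [pval]
    · simp [pval, h]

theorem vval_zero : vval (0 : Fin d → Poly d) = 0 := by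
  ext x i
  simp [vval, pval]

/-- The degree drop behind `div V_h ⊆ Q_h`. It holds monomial by monomial, and truncated subtraction
covers constants. -/
theorem totalDegree_pderiv_le (i : Fin d) (p : Poly d) :
    (MvPolynomial.pderiv i p).totalDegree ≤ p.totalDegree - 1 := by
  rw [p.as_sum, map_sum, ← p.as_sum]
  refine MvPolynomial.totalDegree_finsetSum_le fun s hs => ?_
  rw [MvPolynomial.pderiv_monomial]
  -- If the variable is absent, the coefficient `s i` kills the differentiated monomial; otherwise
  -- its degree drops by exactly one.
  by_cases h : s i = 0
  · simp [h]
  refine (MvPolynomial.totalDegree_monomial_le _ _).trans ?_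
  have h1 : (Finsupp.single i 1 : Fin d →₀ ℕ) ≤ s := by
    rw [Finsupp.single_le_iff]; omega
  have h2 := MvPolynomial.le_totalDegree hs
  have h3 : (s - Finsupp.single i 1).degree + 1 = s.degree := by
    conv_rhs => rw [← tsub_add_cancel_of_le h1]
    simp
  change (s - Finsupp.single i 1).degree ≤ _
  change s.degree ≤ _ at h2
  omega

/-! ### Test functions -/

theorem IsTestFunction.memLp {G : Type*} [NormedAddCommGroup G] [NormedSpace ℝ G]
    {Ω : Set (Rd d)} {φ : Rd d → G} (h : IsTestFunction Ω φ) (p : ℝ≥0∞) : MemLp φ p (vol Ω) :=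
  (h.smooth.continuous.memLp_of_hasCompactSupport h.compact).restrict _

theorem IsTestFunction.component {Ω : Set (Rd d)} {φ : Rd d → Rd d} (h : IsTestFunction Ω φ)
    (i : Fin d) : IsTestFunction Ω (fun x => φ x i) where
  smooth := by have := h.smooth; fun_prop
  compact := h.compact.comp_left (g := fun y : Rd d => y i) rfl
  support_subset := (tsupport_comp_subset (g := fun y : Rd d => y i) rfl φ).trans h.support_subset

theorem IsTestFunction.mono {G : Type*} [NormedAddCommGroup G] [NormedSpace ℝ G]
    {U Ω : Set (Rd d)} {φ : Rd d → G} (h : IsTestFunction U φ) (hU : U ⊆ Ω) :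
    IsTestFunction Ω φ :=
  ⟨h.smooth, h.compact, h.support_subset.trans hU⟩

theorem IsTestFunction.partialDeriv {Ω : Set (Rd d)} {φ : Rd d → ℝ} (h : IsTestFunction Ω φ)
    (i : Fin d) : IsTestFunction Ω (partialDeriv i φ) where
  smooth := by
    have : ContDiff ℝ ∞ (fderiv ℝ φ) := h.smooth.fderiv_right (by simp)
    exact this.clm_apply contDiff_const
  compact := h.compact.fderiv_apply ℝ _
  support_subset := (tsupport_fderiv_apply_subset ℝ _).trans h.support_subset

theorem IsTestFunction.setIntegral_mul {U : Set (Rd d)} {φ : Rd d → ℝ}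
    (h : IsTestFunction U φ) (g : Rd d → ℝ) : ∫ x in U, g x * φ x = ∫ x, g x * φ x :=
  setIntegral_eq_integral_of_forall_compl_eq_zero fun x hx => by
    rw [image_eq_zero_of_notMem_tsupport fun hx' => hx (h.support_subset hx'), mul_zero]

theorem IsTestFunction.integrable_mul {U : Set (Rd d)} {φ : Rd d → ℝ}
    (h : IsTestFunction U φ) {g : Rd d → ℝ} (hg : Continuous g) :
    Integrable (fun x => g x * φ x) :=
  (hg.mul h.smooth.continuous).integrable_of_hasCompactSupport h.compact.mul_left

/-- Compact support of `φ` makes all products integrable on the whole space, so no boundary term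
appears. -/
theorem IsTestFunction.integral_pval_mul_partialDeriv {U : Set (Rd d)} {φ : Rd d → ℝ}
    (h : IsTestFunction U φ) (p : Poly d) (i : Fin d) :
    ∫ x, pval p x * CompressibleStokes.partialDeriv i φ x
      = -∫ x, pval (MvPolynomial.pderiv i p) x * φ x := by
  simp only [← partialDeriv_pval]
  refine integral_mul_fderiv_eq_neg_fderiv_mul_of_integrable ?_ ?_ ?_
    (fun x _ => differentiable_pval p x) (fun x _ => h.smooth.differentiable (by simp) x)
  · have := h.integrable_mul (continuous_pval (MvPolynomial.pderiv i p))
    simp only [← partialDeriv_pval] at this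
    exact this
  · exact (h.partialDeriv i).integrable_mul (continuous_pval p)
  · exact h.integrable_mul (continuous_pval p)

theorem IsTestFunction.setIntegral_partialDeriv {Ω : Set (Rd d)} {φ : Rd d → ℝ}
    (h : IsTestFunction Ω φ) (i : Fin d) :
    ∫ x in Ω, CompressibleStokes.partialDeriv i φ x = 0 := by
  have h1 := (h.partialDeriv i).setIntegral_mul fun _ => 1
  have h2 := h.integral_pval_mul_partialDeriv (MvPolynomial.C 1) i
  simp only [one_mul] at h1
  simpa [h1, pval] using h2

theorem IsTestFunction.classicalDiv_memLp {Ω : Set (Rd d)} {φ : Rd d → Rd d}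
    (h : IsTestFunction Ω φ) (p : ℝ≥0∞) : MemLp (classicalDiv φ) p (vol Ω) :=
  memLp_finsetSum _ fun i _ => ((h.component i).partialDeriv i).memLp p

theorem IsTestFunction.setIntegral_classicalDiv {Ω : Set (Rd d)} {φ : Rd d → Rd d}
    (h : IsTestFunction Ω φ) : ∫ x in Ω, classicalDiv φ x = 0 := by
  unfold classicalDiv
  rw [integral_finsetSum _ fun i _ =>
    memLp_one_iff_integrable.1 (((h.component i).partialDeriv i).memLp 1)]
  exact Finset.sum_eq_zero fun i _ => (h.component i).setIntegral_partialDeriv i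

theorem IsH1WithGradient.setIntegral_inner_gradient {Ω : Set (Rd d)} {q : Rd d → ℝ}
    {f φ : Rd d → Rd d} (hq : IsH1WithGradient Ω q f) (h : IsTestFunction Ω φ) :
    ∫ x in Ω, inner ℝ (f x) (φ x) = -∫ x in Ω, q x * classicalDiv φ x := by
  have hf (i : Fin d) : MemLp (fun x => f x i) 2 (vol Ω) :=
    (EuclideanSpace.proj i : Rd d →L[ℝ] ℝ).comp_memLp' hq.memLp_gradient
  simp only [classicalDiv, Finset.mul_sum, PiLp.inner_apply, RCLike.inner_apply, conj_trivial]
  have h1 (i : Fin d) : Integrable (fun x => q x * partialDeriv i (fun y => φ y i) x) (vol Ω) :=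
    MemLp.integrable_mul hq.memLp (((h.component i).partialDeriv i).memLp 2)
  have h2 (i : Fin d) : Integrable (fun x => φ x i * f x i) (vol Ω) :=
    MemLp.integrable_mul ((h.component i).memLp 2) (hf i)
  rw [integral_finsetSum _ fun i _ => h1 i, integral_finsetSum _ fun i _ => h2 i,
    ← Finset.sum_neg_distrib]
  refine Finset.sum_congr rfl fun i _ => ?_
  rw [hq.weak _ (h.component i) i, neg_neg]
  simp only [mul_comm]

/-! ### `L²` limits and weak divergences -/

/-- Continuity of the `L²` inner product. It carries identities for test fields over to their limits
in `H₀(div)`. -/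
theorem tendsto_integral_inner_of_eLpNorm {X E : Type*} [MeasurableSpace X]
    [NormedAddCommGroup E] [InnerProductSpace ℝ E] {μ : Measure X} {f v : X → E}
    {φ : ℕ → X → E} (hf : MemLp f 2 μ) (hv : MemLp v 2 μ) (hφ : ∀ n, MemLp (φ n) 2 μ)
    (h : Tendsto (fun n => eLpNorm (fun x => v x - φ n x) 2 μ) atTop (𝓝 0)) :
    Tendsto (fun n => ∫ x, inner ℝ (f x) (φ n x) ∂μ) atTop (𝓝 (∫ x, inner ℝ (f x) (v x) ∂μ)) := by
  have key {g : X → E} (hg : MemLp g 2 μ) :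
      inner ℝ (hf.toLp f) (hg.toLp g) = ∫ x, inner ℝ (f x) (g x) ∂μ := by
    rw [L2.inner_def]
    refine integral_congr_ae ?_
    filter_upwards [hf.coeFn_toLp, hg.coeFn_toLp] with x h1 h2
    rw [h1, h2]
  have hlim : Tendsto (fun n => (hφ n).toLp (φ n)) atTop (𝓝 (hv.toLp v)) := by
    rw [Lp.tendsto_Lp_iff_tendsto_eLpNorm'']
    refine h.congr fun n => ?_
    rw [← eLpNorm_neg]
    congr 1
    ext x
    simp
  have := (tendsto_const_nhds (x := hf.toLp f)).inner (𝕜 := ℝ) hlim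
  simpa only [key] using this

theorem MemHdiv.hasWeakDiv {Ω : Set (Rd d)} {v : Rd d → Rd d} (h : MemHdiv Ω v) :
    HasWeakDiv Ω v (weakDiv Ω v) := by
  unfold weakDiv
  rw [dif_pos h.2]
  exact h.2.choose_spec

theorem hasWeakDiv_zero (Ω : Set (Rd d)) : HasWeakDiv Ω 0 0 where
  memLp := MemLp.zero
  weak := by simp

/-- A field that agrees on an open set `U` with a polynomial has there the divergence of that
polynomial as weak divergence. -/
theorem HasWeakDiv.ae_eq_of_eqOn {U Ω : Set (Rd d)} {v : Rd d → Rd d} {w : Rd d → ℝ}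
    (hw : HasWeakDiv Ω v w) (hU : IsOpen U) (hUΩ : U ⊆ Ω) (hΩ : volume Ω ≠ ⊤)
    {p : Fin d → Poly d} (hp : Set.EqOn v (vval p) U) :
    ∀ᵐ x, x ∈ U → w x = pval (∑ i, MvPolynomial.pderiv i (p i)) x := by
  have : IsFiniteMeasure (vol Ω) := ⟨by simpa using hΩ.lt_top⟩
  set D : Poly d := ∑ i, MvPolynomial.pderiv i (p i) with hD
  have hwloc : LocallyIntegrableOn w U :=
    have hwi : IntegrableOn w Ω := MemLp.integrable (q := 2) (by simp) hw.memLp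
    (hwi.mono_set hUΩ).locallyIntegrableOn
  -- Fundamental lemma of the calculus of variations: it suffices that `w - D` integrates to zero
  -- against test functions supported in `U`.
  have key := hU.ae_eq_zero_of_integral_contDiff_smul_eq_zero (μ := volume)
    (f := fun x => w x - pval D x)
    (hwloc.sub ((continuous_pval D).locallyIntegrable.locallyIntegrableOn U)) ?_
  · filter_upwards [key] with x hx hxU
    exact sub_eq_zero.1 (hx hxU)
  intro φ hφ hφc hφU
  have h : IsTestFunction U φ := ⟨hφ, hφc, hφU⟩
  have hwφ : ∫ x, w x * φ x = ∫ x, pval D x * φ x := by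
    rw [← (h.mono hUΩ).setIntegral_mul, hw.weak φ (h.mono hUΩ)]
    have h1 : ∀ x, ∑ i, v x i * partialDeriv i φ x = ∑ i, pval (p i) x * partialDeriv i φ x := by
      intro x
      refine Finset.sum_congr rfl fun i _ => ?_
      by_cases hx : x ∈ U
      · rw [hp hx]; rfl
      · rw [image_eq_zero_of_notMem_tsupport
          fun hx' => hx ((h.partialDeriv i).support_subset hx'), mul_zero, mul_zero]
    simp only [h1]
    have h2 : ∀ x, pval D x * φ x
        = ∑ i, pval (MvPolynomial.pderiv i (p i)) x * φ x := by
      intro x; simp [hD, pval, Finset.sum_mul]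
    simp only [h2]
    have h3 (i : Fin d) := ((h.mono hUΩ).partialDeriv i).integrable_mul (continuous_pval (p i))
    rw [integral_finsetSum _ fun i _ => (h3 i).integrableOn,
      integral_finsetSum _ fun i _ => h.integrable_mul (continuous_pval _),
      ← Finset.sum_neg_distrib]
    refine Finset.sum_congr rfl fun i _ => ?_
    rw [((h.mono hUΩ).partialDeriv i).setIntegral_mul, h.integral_pval_mul_partialDeriv, neg_neg]
  have hwi : Integrable (fun x => w x * φ x) := by
    have : IntegrableOn (fun x => w x * φ x) Ω :=
      MemLp.integrable_mul hw.memLp ((h.mono hUΩ).memLp 2)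
    rwa [integrableOn_iff_integrable_of_support_subset] at this
    exact fun x hx => hUΩ (hφU (subset_tsupport _ (right_ne_zero_of_mul hx)))
  have : ∀ x, φ x • (w x - pval D x) = w x * φ x - pval D x * φ x := fun x => by
    rw [smul_eq_mul]; ring
  simp only [this]
  rw [integral_sub hwi (h.integrable_mul (continuous_pval D)), hwφ, sub_self]

/-- `weakDiv` is a chosen representative, so for the zero field it is known to vanish only almost
everywhere; this comes from comparison with the zero polynomial on `U = Ω`. -/
theorem memH0div_zero {Ω : Set (Rd d)} (hΩ : IsOpen Ω) (hfin : volume Ω ≠ ⊤) :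
    MemH0div Ω (0 : Rd d → Rd d) := by
  have h0 : MemHdiv Ω (0 : Rd d → Rd d) := ⟨MemLp.zero, 0, hasWeakDiv_zero Ω⟩
  have hw : weakDiv Ω (0 : Rd d → Rd d) =ᵐ[vol Ω] 0 := by
    rw [EventuallyEq, ae_restrict_iff' hΩ.measurableSet]
    filter_upwards [h0.hasWeakDiv.ae_eq_of_eqOn hΩ subset_rfl hfin (p := 0)
      (fun x _ => by ext i; simp [vval, pval])] with x hx hxΩ
    simpa [pval] using hx hxΩ
  refine ⟨h0, fun _ => 0, fun _ => ⟨contDiff_const, HasCompactSupport.zero, by simp⟩, by simp, ?_⟩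
  have : (fun x => weakDiv Ω (0 : Rd d → Rd d) x - classicalDiv (0 : Rd d → Rd d) x)
      =ᵐ[vol Ω] 0 := by
    filter_upwards [hw] with x hx
    simp [hx, classicalDiv, partialDeriv]
  simp [eLpNorm_congr_ae this]

/-- Integration by parts for `q ∈ H¹(Ω)` and `v ∈ H₀(div, Ω)`. -/
theorem IsH1WithGradient.setIntegral_inner {Ω : Set (Rd d)} {q : Rd d → ℝ}
    {f v : Rd d → Rd d} (hq : IsH1WithGradient Ω q f) (hv : MemH0div Ω v) :
    ∫ x in Ω, inner ℝ (f x) (v x) = -∫ x in Ω, q x * weakDiv Ω v x := by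
  obtain ⟨hv, φ, hφ, h1, h2⟩ := hv
  have l1 := tendsto_integral_inner_of_eLpNorm hq.memLp_gradient hv.1 (fun n => (hφ n).memLp 2) h1
  have l2 := tendsto_integral_inner_of_eLpNorm hq.memLp hv.hasWeakDiv.memLp
    (fun n => (hφ n).classicalDiv_memLp 2) h2
  simp only [RCLike.inner_apply, conj_trivial] at l2
  refine tendsto_nhds_unique l1 ?_
  simp only [hq.setIntegral_inner_gradient (hφ _)]
  simpa only [mul_comm] using l2.neg

/-- Divergences of test fields integrate to zero, and pairing with the constant `1 ∈ L²` passes to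
the limit. -/
theorem MemH0div.setIntegral_weakDiv {Ω : Set (Rd d)} {v : Rd d → Rd d} (hv : MemH0div Ω v)
    (hΩ : volume Ω ≠ ⊤) : ∫ x in Ω, weakDiv Ω v x = 0 := by
  have : IsFiniteMeasure (vol Ω) := ⟨by simpa using hΩ.lt_top⟩
  obtain ⟨hv, φ, hφ, -, h2⟩ := hv
  have l2 := tendsto_integral_inner_of_eLpNorm (memLp_const (1 : ℝ)) hv.hasWeakDiv.memLp
    (fun n => (hφ n).classicalDiv_memLp 2) h2
  simp only [RCLike.inner_apply, conj_trivial, mul_one] at l2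
  simp only [(hφ _).setIntegral_classicalDiv] at l2
  exact tendsto_nhds_unique l2 tendsto_const_nhds

/-! ### Geometry of the triangulation -/

/-- A Lipschitz domain has no slits: arbitrarily near a boundary point, strictly below the graph,
lie points outside the closure. -/
theorem IsLipschitzDomain.interior_closure_subset {Ω : Set (Rd d)} (h : IsLipschitzDomain Ω) :
    interior (closure Ω) ⊆ Ω := by
  intro x hx
  by_contra hxΩ
  have hxf : x ∈ frontier Ω := by
    rw [h.isOpen.frontier_eq]
    exact ⟨interior_subset hx, hxΩ⟩
  obtain ⟨e, he, L, γ, hγ, U, hU, hiff⟩ := h.lipschitz_boundary x hxf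
  have hle : (inner ℝ e x : ℝ) ≤ γ ((Submodule.span ℝ {e})ᗮ.orthogonalProjectionOnto x) :=
    not_lt.1 fun hlt => hxΩ ((hiff x (mem_of_mem_nhds hU)).2 hlt)
  -- Moving down along `-e` keeps the horizontal coordinates, so `x - t • e` is strictly below the
  -- graph while still inside the neighborhood and the closure of `Ω`.
  have hline : Tendsto (fun t : ℝ => x - t • e) (𝓝[>] 0) (𝓝 x) := by
    have : Continuous fun t : ℝ => x - t • e := by fun_prop
    simpa using (this.tendsto 0).mono_left nhdsWithin_le_nhds
  have hev := hline.eventually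
    ((isOpen_interior.inter isOpen_interior).mem_nhds ⟨hx, mem_interior_iff_mem_nhds.2 hU⟩)
  obtain ⟨t, ⟨hyΩ, hyU⟩, ht⟩ := (hev.and self_mem_nhdsWithin).exists
  set y := x - t • e with hy
  have hPe : (Submodule.span ℝ {e})ᗮ.orthogonalProjectionOnto e = 0 := by
    rw [Submodule.orthogonalProjectionOnto_eq_zero_iff]
    exact Submodule.le_orthogonal_orthogonal _ (Submodule.mem_span_singleton_self e)
  have hPy : (Submodule.span ℝ {e})ᗮ.orthogonalProjectionOnto y
      = (Submodule.span ℝ {e})ᗮ.orthogonalProjectionOnto x := by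
    simp [hy, hPe]
  have hylt : (inner ℝ e y : ℝ) < γ ((Submodule.span ℝ {e})ᗮ.orthogonalProjectionOnto y) := by
    rw [hPy]
    have : (inner ℝ e y : ℝ) = inner ℝ e x - t := by
      rw [hy, inner_sub_right, inner_smul_right, real_inner_self_eq_norm_sq, he]; ring
    have ht' : 0 < t := ht
    linarith
  have hopen : IsOpen {z : Rd d |
      (inner ℝ e z : ℝ) < γ ((Submodule.span ℝ {e})ᗮ.orthogonalProjectionOnto z)} :=
    isOpen_lt (by fun_prop) (hγ.continuous.comp (by fun_prop))
  -- Lying strictly below the graph is an open condition, so a point of `Ω` near `y` satisfies it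
  -- too, against the graph description.
  obtain ⟨z, ⟨hz, hzU⟩, hzΩ⟩ := mem_closure_iff.1 (interior_subset hyΩ) _
    (hopen.inter isOpen_interior) ⟨hylt, hyU⟩
  exact lt_asymm hz ((hiff z (interior_subset hzU)).1 hzΩ)

theorem IsLipschitzDomain.volume_ne_top {Ω : Set (Rd d)} (h : IsLipschitzDomain Ω) :
    volume Ω ≠ ⊤ :=
  h.isBounded.measure_lt_top.ne

theorem IsLipschitzDomain.volume_real_pos {Ω : Set (Rd d)} (h : IsLipschitzDomain Ω) :
    0 < volume.real Ω :=
  ENNReal.toReal_pos (h.isOpen.measure_pos _ h.isConnected.nonempty).ne' h.volume_ne_top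

theorem memLp_pval {Ω : Set (Rd d)} (hΩ : Bornology.IsBounded Ω) (p : Poly d) (e : ℝ≥0∞) :
    MemLp (pval p) e (vol Ω) := by
  have : IsFiniteMeasure (volume.restrict (closure Ω)) :=
    ⟨by simpa using hΩ.isCompact_closure.measure_lt_top⟩
  obtain ⟨C, hC⟩ := hΩ.isCompact_closure.exists_bound_of_continuousOn
    (continuous_pval p).continuousOn
  refine (MemLp.of_bound (continuous_pval p).aestronglyMeasurable C ?_ :
    MemLp (pval p) e (volume.restrict (closure Ω))).mono_measure
      (Measure.restrict_mono subset_closure le_rfl)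
  exact ae_restrict_of_forall_mem isClosed_closure.measurableSet hC

namespace Triangulation

variable {Ω : Set (Rd d)} {𝒯 : Triangulation Ω}

theorem cell_mem_faces (T : 𝒯.cells) : T.1 ∈ 𝒯.complex.faces := by
  have := T.2
  simp only [cells, Finset.mem_filter, Set.Finite.mem_toFinset] at this
  exact this.1

theorem cell_card (T : 𝒯.cells) : T.1.card = d + 1 := by
  have := T.2
  simp only [cells, Finset.mem_filter] at this
  exact this.2

theorem interior_hull_nonempty_iff {s : Finset (Rd d)}
    (hs : AffineIndependent ℝ ((↑) : s → Rd d)) :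
    (interior (hull s)).Nonempty ↔ s.card = d + 1 := by
  have h := hs.affineSpan_eq_top_iff_card_eq_finrank_add_one
  rw [interior_convexHull_nonempty_iff_affineSpan_eq_top]
  simpa using h

theorem interior_cell_nonempty (T : 𝒯.cells) : (interior (hull T.1)).Nonempty :=
  (interior_hull_nonempty_iff (𝒯.complex.indep (cell_mem_faces T))).2 (cell_card T)

/-- Two cells meet inside the hull of their common vertices, which has interior points only if there
are `d + 1` of them, that is, if the cells coincide. -/
theorem disjoint_interior_cell {S T : 𝒯.cells} (h : S ≠ T) :
    Disjoint (interior (hull S.1)) (interior (hull T.1)) := by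
  classical
  rw [Set.disjoint_iff_inter_eq_empty, ← interior_inter]
  have hsub : hull S.1 ∩ hull T.1 ⊆ hull (S.1 ∩ T.1) := by
    have := 𝒯.complex.inter_subset_convexHull (cell_mem_faces S) (cell_mem_faces T)
    rwa [← Finset.coe_inter] at this
  refine Set.subset_empty_iff.1 ((interior_mono hsub).trans ?_)
  rw [Set.subset_empty_iff, ← Set.not_nonempty_iff_eq_empty, interior_hull_nonempty_iff
    ((𝒯.complex.indep (cell_mem_faces S)).mono (Finset.coe_subset.2 Finset.inter_subset_left))]
  intro hc
  have hST := Finset.eq_of_subset_of_card_le Finset.inter_subset_left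
    (hc.symm ▸ (cell_card S).le : S.1.card ≤ (S.1 ∩ T.1).card)
  have hTS := Finset.eq_of_subset_of_card_le Finset.inter_subset_right
    (hc.symm ▸ (cell_card T).le : T.1.card ≤ (S.1 ∩ T.1).card)
  exact h (Subtype.ext (hST.symm.trans hTS))

theorem interior_cell_subset (hΩ : IsLipschitzDomain Ω) (T : 𝒯.cells) :
    interior (hull T.1) ⊆ Ω := by
  refine (interior_mono ?_).trans hΩ.interior_closure_subset
  rw [← 𝒯.space_eq]
  exact 𝒯.complex.convexHull_subset_space (cell_mem_faces T)

/-- The skeleton of a triangulation is a null set. -/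
theorem ae_exists_mem_interior_cell (𝒯 : Triangulation Ω) (hΩ : IsOpen Ω) :
    ∀ᵐ x ∂(vol Ω), ∃ T : 𝒯.cells, x ∈ interior (hull T.1) := by
  rw [ae_restrict_iff' hΩ.measurableSet]
  have hnull : ∀ᵐ x : Rd d, ∀ T : 𝒯.cells, x ∉ frontier (hull T.1) :=
    -- Boundaries of convex sets are null, and there are finitely many cells.
    ae_all_iff.2 fun T => measure_eq_zero_iff_ae_notMem.1
      ((convex_convexHull ℝ (T.1 : Set (Rd d))).addHaar_frontier volume)
  filter_upwards [hnull] with x hx hxΩ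
  have hxs : x ∈ 𝒯.complex.space := 𝒯.space_eq ▸ subset_closure hxΩ
  obtain ⟨s, hs, hxs⟩ := Geometry.SimplicialComplex.mem_space_iff.1 hxs
  -- Purity enlarges the simplex containing `x` to a full cell.
  obtain ⟨t, ht, hst, hc⟩ := 𝒯.pure s hs
  let T : 𝒯.cells := ⟨t, by simp [cells, ht, hc]⟩
  have hxT : x ∈ hull T.1 := convexHull_mono (Finset.coe_subset.2 hst) hxs
  exact ⟨T, by_contra fun hn => hx T ⟨subset_closure hxT, hn⟩⟩

theorem sum_indicator_interior_cell {E : Type*} [AddCommMonoid E] (g : 𝒯.cells → Rd d → E)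
    {T : 𝒯.cells} {x : Rd d} (hx : x ∈ interior (hull T.1)) :
    ∑ S : 𝒯.cells, (interior (hull S.1)).indicator (g S) x = g T x := by
  rw [Finset.sum_eq_single T, Set.indicator_of_mem hx]
  · intro S _ hS
    exact Set.indicator_of_notMem
      (fun hxS => Set.disjoint_left.1 (disjoint_interior_cell hS) hxS hx) _
  · simp

theorem Scalar.toFun_of_mem (r : 𝒯.Scalar) {T : 𝒯.cells} {x : Rd d}
    (hx : x ∈ interior (hull T.1)) : Scalar.toFun r x = pval (r T) x :=
  sum_indicator_interior_cell (fun T => pval (r T)) hx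

theorem Vector.toFun_of_mem (v : 𝒯.Vector) {T : 𝒯.cells} {x : Rd d}
    (hx : x ∈ interior (hull T.1)) : Vector.toFun v x = vval (v T) x :=
  sum_indicator_interior_cell (fun T => vval (v T)) hx

theorem Scalar.memLp_toFun (r : 𝒯.Scalar) (hΩ : Bornology.IsBounded Ω) (e : ℝ≥0∞) :
    MemLp (Scalar.toFun r) e (vol Ω) :=
  memLp_finsetSum _ fun T _ => (memLp_pval hΩ (r T) e).indicator isOpen_interior.measurableSet

theorem Scalar.toFun_add (r s : 𝒯.Scalar) (x : Rd d) :
    Scalar.toFun (r + s) x = Scalar.toFun r x + Scalar.toFun s x := by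
  simp only [Scalar.toFun, ← Finset.sum_add_distrib]
  refine Finset.sum_congr rfl fun T _ => ?_
  by_cases hx : x ∈ interior (hull T.1) <;> simp [hx, pval]

theorem Scalar.toFun_smul (c : ℝ) (r : 𝒯.Scalar) (x : Rd d) :
    Scalar.toFun (c • r) x = c * Scalar.toFun r x := by
  simp only [Scalar.toFun, Finset.mul_sum]
  refine Finset.sum_congr rfl fun T _ => ?_
  by_cases hx : x ∈ interior (hull T.1) <;> simp [hx, pval, MvPolynomial.smul_eval]

theorem Vector.toFun_zero : Vector.toFun (0 : 𝒯.Vector) = 0 := by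
  have : vval (0 : Fin d → Poly d) = 0 := by ext x i; simp [vval, pval]
  ext x
  simp [Vector.toFun, vval_zero]

/-- The piecewise divergence of a piecewise polynomial vector field. -/
noncomputable def Vector.div (v : 𝒯.Vector) : 𝒯.Scalar :=
  fun T => ∑ i, MvPolynomial.pderiv i (v T i)

theorem Vector.div_mem_Qh {k : ℕ} {v : 𝒯.Vector} (hv : v ∈ 𝒯.Vh k) : Vector.div v ∈ 𝒯.Qh k :=
  fun T => MvPolynomial.totalDegree_finsetSum_le fun i _ =>
    (totalDegree_pderiv_le i _).trans (Nat.sub_le_sub_right (hv.1 T i) 1)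

theorem weakDiv_toFun_ae_eq (hΩ : IsLipschitzDomain Ω) {v : 𝒯.Vector}
    (hv : MemHdiv Ω (Vector.toFun v)) :
    weakDiv Ω (Vector.toFun v) =ᵐ[vol Ω] Scalar.toFun (Vector.div v) := by
  have h : ∀ᵐ x : Rd d, ∀ T : 𝒯.cells, x ∈ interior (hull T.1) →
      weakDiv Ω (Vector.toFun v) x = pval (Vector.div v T) x :=
    ae_all_iff.2 fun T => hv.hasWeakDiv.ae_eq_of_eqOn isOpen_interior
      (interior_cell_subset hΩ T) hΩ.volume_ne_top fun x hx => Vector.toFun_of_mem v hx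
  filter_upwards [ae_restrict_of_ae h, 𝒯.ae_exists_mem_interior_cell hΩ.isOpen] with x hx hT
  obtain ⟨T, hT⟩ := hT
  rw [hx T hT, Scalar.toFun_of_mem _ hT]

/-! ### The `L²` projection -/

/-- The image of `Q_h` in `L²` is the range of a linear map from a finite-dimensional coefficient
space, so orthogonal projection onto it exists. -/
theorem exists_isL2Projection (𝒯 : Triangulation Ω) (hΩ : Bornology.IsBounded Ω) (k : ℕ)
    {q : Rd d → ℝ} (hq : MemLp q 2 (vol Ω)) : ∃ π : 𝒯.Scalar, 𝒯.IsL2Projection k q π := by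
  let P := 𝒯.cells → MvPolynomial.restrictTotalDegree (Fin d) ℝ (k - 1)
  let ι : P → 𝒯.Scalar := fun r T => (r T : Poly d)
  let Φ : P →ₗ[ℝ] Lp ℝ 2 (vol Ω) :=
    { toFun := fun r => (Scalar.memLp_toFun (ι r) hΩ 2).toLp _
      map_add' := fun r s => by
        rw [← MemLp.toLp_add]
        exact MemLp.toLp_congr _ _ (ae_of_all _ fun x => Scalar.toFun_add (ι r) (ι s) x)
      map_smul' := fun c r => by
        rw [RingHom.id_apply, ← MemLp.toLp_const_smul]
        exact MemLp.toLp_congr _ _ (ae_of_all _ fun x => Scalar.toFun_smul c (ι r) x) }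
  obtain ⟨w, ⟨r, rfl⟩, hr⟩ :=
    Submodule.HasOrthogonalProjection.exists_orthogonal (K := LinearMap.range Φ) (hq.toLp q)
  refine ⟨ι r, fun T => (MvPolynomial.mem_restrictTotalDegree _ _ _).1 (r T).2, fun s hs => ?_⟩
  let s' : P := fun T => ⟨s T, (MvPolynomial.mem_restrictTotalDegree _ _ _).2 (hs T)⟩
  have h := (Submodule.mem_orthogonal' _ _).1 hr (Φ s') ⟨s', rfl⟩
  rw [L2.inner_def] at h
  rw [← h]
  refine integral_congr_ae ?_
  filter_upwards [Lp.coeFn_sub (hq.toLp q) (Φ r), hq.coeFn_toLp,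
    (Scalar.memLp_toFun (ι r) hΩ 2).coeFn_toLp, (Scalar.memLp_toFun s hΩ 2).coeFn_toLp]
    with x h1 h2 h3 h4
  have h3' : (Φ r) x = Scalar.toFun (ι r) x := h3
  have h4' : (Φ s') x = Scalar.toFun s x := h4
  rw [h1, Pi.sub_apply, h2, h3', h4', RCLike.inner_apply, conj_trivial, mul_comm]

section Projection

variable {k : ℕ} {q : Rd d → ℝ} {π : 𝒯.Scalar}

theorem IsL2Projection.setIntegral_mul (hπ : 𝒯.IsL2Projection k q π)
    (hΩ : Bornology.IsBounded Ω) (hq : MemLp q 2 (vol Ω)) {r : 𝒯.Scalar} (hr : r ∈ 𝒯.Qh k) :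
    ∫ x in Ω, Scalar.toFun π x * Scalar.toFun r x = ∫ x in Ω, q x * Scalar.toFun r x := by
  have h := hπ.2 r hr
  simp only [sub_mul] at h
  have hr2 := Scalar.memLp_toFun r hΩ 2
  have h1 : Integrable (fun x => q x * Scalar.toFun r x) (vol Ω) := MemLp.integrable_mul hq hr2
  have h2 : Integrable (fun x => Scalar.toFun π x * Scalar.toFun r x) (vol Ω) :=
    MemLp.integrable_mul (Scalar.memLp_toFun π hΩ 2) hr2
  rw [integral_sub h1 h2] at h
  linarith

theorem IsL2Projection.setIntegral (hπ : 𝒯.IsL2Projection k q π)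
    (hΩ : IsLipschitzDomain Ω) (hq : MemLp q 2 (vol Ω)) :
    ∫ x in Ω, Scalar.toFun π x = ∫ x in Ω, q x := by
  have h1 : ∀ᵐ x ∂(vol Ω), Scalar.toFun (fun _ : 𝒯.cells => MvPolynomial.C 1) x = 1 := by
    filter_upwards [𝒯.ae_exists_mem_interior_cell hΩ.isOpen] with x ⟨T, hT⟩
    simp [Scalar.toFun_of_mem _ hT, pval]
  have h := hπ.setIntegral_mul hΩ.isBounded hq (r := fun _ => MvPolynomial.C 1)
    (fun T => by simp)
  rwa [integral_congr_ae (f := fun x => Scalar.toFun π x * _) (g := Scalar.toFun π) (h1.mono fun x hx => by simp only [hx, mul_one]),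
    integral_congr_ae (f := fun x => q x * _) (g := q) (h1.mono fun x hx => by simp only [hx, mul_one])] at h

/-- The indicator of a single cell has degree zero, hence is an admissible test function in `Q_h`
for every `k`. -/
theorem IsL2Projection.setIntegral_cell (hπ : 𝒯.IsL2Projection k q π)
    (hΩ : IsLipschitzDomain Ω) (hq : MemLp q 2 (vol Ω)) (T : 𝒯.cells) :
    ∫ x in interior (hull T.1), pval (π T) x = ∫ x in interior (hull T.1), q x := by
  classical
  have hU : MeasurableSet (interior (hull T.1)) := isOpen_interior.measurableSet
  let r : 𝒯.Scalar := fun S => if S = T then 1 else 0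
  have hr : Scalar.toFun r = (interior (hull T.1)).indicator 1 := by
    ext x
    rw [Scalar.toFun, Finset.sum_eq_single T]
    · congr 1; ext y; simp [r, pval]
    · intro S _ hS
      have : pval (r S) = 0 := by ext y; simp [r, pval, hS]
      simp [this]
    · simp
  have h := hπ.setIntegral_mul hΩ.isBounded hq (r := r)
    (fun S => by by_cases hS : S = T <;> simp [r, hS])
  have key (g : Rd d → ℝ) : ∫ x in Ω, g x * Scalar.toFun r x
      = ∫ x in interior (hull T.1), g x := by
    have : (fun x => g x * Scalar.toFun r x) = (interior (hull T.1)).indicator g := by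
      ext x
      by_cases hx : x ∈ interior (hull T.1) <;> simp [hr, hx]
    rw [this, setIntegral_indicator hU, Set.inter_eq_right.2 (interior_cell_subset hΩ T)]
  rw [key, key] at h
  rw [← h]
  exact setIntegral_congr_fun hU fun x hx => (Scalar.toFun_of_mem π hx).symm

end Projection

/-! ### The hydrostatic solution -/

theorem pval_hydrostaticDensity (cM κ : ℝ) (π : 𝒯.Scalar) (T : 𝒯.cells) (x : Rd d) :
    pval (hydrostaticDensity cM κ π T) x = cM⁻¹ * pval (π T) x + κ := by
  simp [hydrostaticDensity, pval]

theorem toFun_hydrostaticDensity_ae_eq (hΩ : IsOpen Ω) (cM κ : ℝ) (π : 𝒯.Scalar) :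
    ∀ᵐ x ∂(vol Ω),
      Scalar.toFun (hydrostaticDensity cM κ π) x = cM⁻¹ * Scalar.toFun π x + κ := by
  filter_upwards [𝒯.ae_exists_mem_interior_cell hΩ] with x ⟨T, hT⟩
  rw [Scalar.toFun_of_mem _ hT, Scalar.toFun_of_mem _ hT, pval_hydrostaticDensity]

theorem hydrostaticDensity_mem_Qh {k : ℕ} {cM κ : ℝ} {π : 𝒯.Scalar} (hπ : π ∈ 𝒯.Qh k) :
    hydrostaticDensity cM κ π ∈ 𝒯.Qh k := by
  intro T
  refine (MvPolynomial.totalDegree_add _ _).trans (max_le ?_ (by simp))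
  refine (MvPolynomial.totalDegree_mul _ _).trans ?_
  simpa using hπ T

theorem zero_mem_Vh (𝒯 : Triangulation Ω) (hΩ : IsLipschitzDomain Ω) (k : ℕ) :
    (0 : 𝒯.Vector) ∈ 𝒯.Vh k :=
  ⟨fun T i => by simp, by rw [Vector.toFun_zero]; exact memH0div_zero hΩ.isOpen hΩ.volume_ne_top⟩

theorem zero_mem_VhHat (𝒯 : Triangulation Ω) (k : ℕ) : (0 : 𝒯.FacetVector) ∈ 𝒯.VhHat k := by
  have : vval (0 : Fin d → Poly d) = 0 := by ext x i; simp [vval, pval]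
  exact ⟨fun F i => by simp, fun F n _ x _ => by simp [vval_zero], fun F _ x _ => by simp [vval_zero]⟩

theorem aForm_zero (k : ℕ) (ν α : ℝ) (v : 𝒯.Vector) (vhat : 𝒯.FacetVector) :
    𝒯.aForm k ν α 0 0 v vhat = 0 := by
  have h2 (w : Fin d → Poly d) (x : Rd d) : gradInner 0 w x = 0 := by simp [gradInner, pval]
  have h3 (n x : Rd d) : gradMul (0 : Fin d → Poly d) n x = 0 := by
    ext i; simp [gradMul, pval]
  have h4 (T : 𝒯.cells) (F : 𝒯.facets) (x : Rd d) : 𝒯.tangJump 0 0 T F x = 0 := by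
    simp [tangJump, tangential, vval_zero]
  simp [aForm, bdryIntegral, h2, h3, h4]

theorem cForm_zero (r l : 𝒯.Scalar) : 𝒯.cForm r 0 l = 0 := by
  simp [cForm, bdryIntegral, vval_zero]

theorem gForm_zero (r : 𝒯.Scalar) (v : 𝒯.Vector) : 𝒯.gForm 0 r v = 0 := by
  simp [gForm]

/-- The discrete hydrostatic balance: `κ` drops out because `div v` has mean zero, and the
projection is invisible because `div v ∈ Q_h`. -/
theorem bForm_hydrostaticDensity (hΩ : IsLipschitzDomain Ω) {k : ℕ} {cM κ : ℝ} (hcM : cM ≠ 0)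
    {q : Rd d → ℝ} {f : Rd d → Rd d} {π : 𝒯.Scalar} (hq : IsH1WithGradient Ω q f)
    (hπ : 𝒯.IsL2Projection k q π) {v : 𝒯.Vector} (hv : v ∈ 𝒯.Vh k) :
    𝒯.bForm cM (hydrostaticDensity cM κ π) v = 𝒯.fForm f v := by
  have hdiv := weakDiv_toFun_ae_eq hΩ hv.2.1
  have hw := hv.2.1.hasWeakDiv.memLp
  have : IsFiniteMeasure (vol Ω) := ⟨by simpa using hΩ.volume_ne_top.lt_top⟩
  have h1 : ∫ x in Ω, (cM * Scalar.toFun (hydrostaticDensity cM κ π) x)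
        * weakDiv Ω (Vector.toFun v) x
      = ∫ x in Ω, (Scalar.toFun π x * weakDiv Ω (Vector.toFun v) x
        + cM * κ * weakDiv Ω (Vector.toFun v) x) := by
    refine integral_congr_ae ?_
    filter_upwards [toFun_hydrostaticDensity_ae_eq hΩ.isOpen cM κ π] with x hx
    rw [hx]
    field_simp
  have h2 (g : Rd d → ℝ) : ∫ x in Ω, g x * weakDiv Ω (Vector.toFun v) x
      = ∫ x in Ω, g x * Scalar.toFun (Vector.div v) x :=
    integral_congr_ae (hdiv.mono fun x hx => by simp only [hx])
  have i1 : Integrable (fun x => Scalar.toFun π x * weakDiv Ω (Vector.toFun v) x) (vol Ω) :=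
    MemLp.integrable_mul (Scalar.memLp_toFun π hΩ.isBounded 2) hw
  have i2 : Integrable (weakDiv Ω (Vector.toFun v)) (vol Ω) :=
    MemLp.integrable (q := 2) (by simp) hw
  rw [bForm, fForm, h1, integral_add i1 (i2.const_mul _), integral_const_mul,
    hv.2.setIntegral_weakDiv hΩ.volume_ne_top, hq.setIntegral_inner hv.2, mul_zero, add_zero,
    h2, h2, hπ.setIntegral_mul hΩ.isBounded hq.memLp (Vector.div_mem_Qh hv)]

theorem setIntegral_hydrostaticDensity (hΩ : IsLipschitzDomain Ω) {k : ℕ} {cM M : ℝ}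
    {q : Rd d → ℝ} {π : 𝒯.Scalar} (hq : MemLp q 2 (vol Ω)) (hπ : 𝒯.IsL2Projection k q π) :
    ∫ x in Ω, Scalar.toFun
      (hydrostaticDensity cM ((M - (∫ x in Ω, q x) / cM) / volume.real Ω) π) x = M := by
  have : IsFiniteMeasure (vol Ω) := ⟨by simpa using hΩ.volume_ne_top.lt_top⟩
  have hvol := hΩ.volume_real_pos.ne'
  have i1 : Integrable (Scalar.toFun π) (vol Ω) :=
    memLp_one_iff_integrable.1 (Scalar.memLp_toFun π hΩ.isBounded 1)
  rw [integral_congr_ae (toFun_hydrostaticDensity_ae_eq hΩ.isOpen _ _ π),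
    integral_add (i1.const_mul _) (integrable_const _), integral_const_mul,
    hπ.setIntegral hΩ hq, setIntegral_const, smul_eq_mul, mul_div_cancel₀ _ hvol]
  ring

theorem isDiscreteSolution_hydrostatic (hΩ : IsLipschitzDomain Ω) (k : ℕ) (ν α : ℝ) {cM : ℝ}
    (hcM : cM ≠ 0) (M : ℝ) {q : Rd d → ℝ} {f : Rd d → Rd d} {π : 𝒯.Scalar}
    (hq : IsH1WithGradient Ω q f) (hπ : 𝒯.IsL2Projection k q π) :
    𝒯.IsDiscreteSolution k ν α cM M 0 f 0 0
      (hydrostaticDensity cM ((M - (∫ x in Ω, q x) / cM) / volume.real Ω) π) where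
  velocity_mem := 𝒯.zero_mem_Vh hΩ k
  hybrid_mem := 𝒯.zero_mem_VhHat k
  density_mem := hydrostaticDensity_mem_Qh hπ.1
  momentum v hv vhat _ := by
    rw [aForm_zero, gForm_zero, zero_add, add_zero, bForm_hydrostaticDensity hΩ hcM hq hπ hv]
  continuity l _ := cForm_zero _ l
  mass := setIntegral_hydrostaticDensity hΩ hq.memLp hπ

/-! ### Sign of the lowest-order density -/

/-- For `k = 1` the hydrostatic density is on each element the mean of `q / c_M + κ`. -/
theorem pval_hydrostaticDensity_mul_volume (hΩ : IsLipschitzDomain Ω) {cM κ : ℝ} {q : Rd d → ℝ}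
    {π : 𝒯.Scalar} (hq : MemLp q 2 (vol Ω)) (hπ : 𝒯.IsL2Projection 1 q π) (T : 𝒯.cells)
    (x : Rd d) :
    pval (hydrostaticDensity cM κ π T) x * volume.real (interior (hull T.1))
      = ∫ y in interior (hull T.1), (q y / cM + κ) := by
  have : IsFiniteMeasure (vol Ω) := ⟨by simpa using hΩ.volume_ne_top.lt_top⟩
  have hfin : volume (interior (hull T.1)) ≠ ⊤ :=
    ((measure_mono (interior_cell_subset hΩ T)).trans_lt hΩ.volume_ne_top.lt_top).ne
  have hqi : IntegrableOn q (interior (hull T.1)) := by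
    have : IntegrableOn q Ω := MemLp.integrable (q := 2) (by simp) hq
    exact this.mono_set (interior_cell_subset hΩ T)
  -- For `k = 1` the degree bound `k - 1` is zero, so the projection is constant on each cell.
  obtain ⟨c, hc⟩ : ∃ c, π T = MvPolynomial.C c :=
    ⟨_, MvPolynomial.totalDegree_eq_zero_iff_eq_C.1 (Nat.le_zero.1 (hπ.1 T))⟩
  have hval (y : Rd d) : pval (π T) y = c := by simp [hc, pval]
  have h := hπ.setIntegral_cell hΩ hq T
  simp only [hval, setIntegral_const, smul_eq_mul] at h
  rw [integral_add (hqi.div_const cM) (integrableOn_const hfin), integral_div, ← h,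
    setIntegral_const, smul_eq_mul, pval_hydrostaticDensity, hval]
  ring

theorem volume_real_interior_cell_pos (hΩ : IsLipschitzDomain Ω) (T : 𝒯.cells) :
    0 < volume.real (interior (hull T.1)) :=
  ENNReal.toReal_pos (isOpen_interior.measure_pos _ (interior_cell_nonempty T)).ne'
    ((measure_mono (interior_cell_subset hΩ T)).trans_lt hΩ.volume_ne_top.lt_top).ne

theorem hydrostaticDensity_nonneg (hΩ : IsLipschitzDomain Ω) {cM κ : ℝ} {q : Rd d → ℝ}
    {π : 𝒯.Scalar} (hq : MemLp q 2 (vol Ω)) (hπ : 𝒯.IsL2Projection 1 q π)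
    (hpos : ∀ᵐ x ∂(vol Ω), 0 ≤ q x / cM + κ) (T : 𝒯.cells) (x : Rd d) :
    0 ≤ pval (hydrostaticDensity cM κ π T) x := by
  refine nonneg_of_mul_nonneg_left ?_ (volume_real_interior_cell_pos hΩ T)
  rw [pval_hydrostaticDensity_mul_volume hΩ hq hπ]
  exact setIntegral_nonneg_of_ae_restrict
    (ae_restrict_of_ae_restrict_of_subset (interior_cell_subset hΩ T) hpos)

theorem hydrostaticDensity_pos (hΩ : IsLipschitzDomain Ω) {cM κ : ℝ} {q : Rd d → ℝ}
    {π : 𝒯.Scalar} (hq : MemLp q 2 (vol Ω)) (hπ : 𝒯.IsL2Projection 1 q π)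
    (hpos : ∀ᵐ x ∂(vol Ω), 0 < q x / cM + κ) (T : 𝒯.cells) (x : Rd d) :
    0 < pval (hydrostaticDensity cM κ π T) x := by
  have : IsFiniteMeasure (vol Ω) := ⟨by simpa using hΩ.volume_ne_top.lt_top⟩
  have hvol := volume_real_interior_cell_pos hΩ T
  refine pos_of_mul_pos_left ?_ hvol.le
  rw [pval_hydrostaticDensity_mul_volume hΩ hq hπ]
  have hT := ae_restrict_of_ae_restrict_of_subset (interior_cell_subset hΩ T) hpos
  have hi : IntegrableOn (fun y => q y / cM + κ) (interior (hull T.1)) := by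
    have h1 : Integrable q (vol Ω) := MemLp.integrable (q := 2) (by simp) hq
    have h2 : IntegrableOn (fun y => q y / cM + κ) Ω :=
      (h1.div_const cM).add (integrable_const κ)
    exact h2.mono_set (interior_cell_subset hΩ T)
  -- The integral is positive because the integrand is nonzero almost everywhere on a cell of
  -- positive measure.
  rw [integral_pos_iff_support_of_nonneg_ae (hT.mono fun y hy => hy.le) hi]
  have hsupp : (Function.support fun y => q y / cM + κ) =ᵐ[volume.restrict (interior (hull T.1))]
      Set.univ :=
    eventuallyEq_univ.2 (hT.mono fun y hy => hy.ne')
  rw [measure_congr hsupp, Measure.restrict_apply_univ]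
  exact isOpen_interior.measure_pos _ (interior_cell_nonempty T)

end Triangulation

/-- The constant in the definition of an admissible potential is determined by the mass. -/
theorem IsAdmissiblePotential.ae_nonneg {Ω : Set (Rd d)} (hΩ : IsLipschitzDomain Ω) {cM M : ℝ}
    {q : Rd d → ℝ} (hq : MemLp q 2 (vol Ω)) (h : IsAdmissiblePotential Ω cM M q) :
    ∀ᵐ x ∂(vol Ω), 0 ≤ q x / cM + (M - (∫ x in Ω, q x) / cM) / volume.real Ω := by
  have : IsFiniteMeasure (vol Ω) := ⟨by simpa using hΩ.volume_ne_top.lt_top⟩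
  obtain ⟨C, hC, hM⟩ := h
  have hqi : Integrable q (vol Ω) := MemLp.integrable (q := 2) (by simp) hq
  rw [integral_div, integral_sub hqi (integrable_const C), setIntegral_const, smul_eq_mul] at hM
  -- Solving the mass condition for `C` turns `q / c_M + κ` into the given nonnegative density `(q -
  -- C) / c_M`.
  have hκ : (M - (∫ x in Ω, q x) / cM) / volume.real Ω = -C / cM := by
    rw [div_eq_iff hΩ.volume_real_pos.ne', ← hM]
    ring
  filter_upwards [hC] with x hx
  rwa [hκ, neg_div, ← sub_eq_add_neg, ← sub_div]

end CompressibleStokes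

/-! ### The main theorem -/

theorem mainTheorem3 {d : ℕ} (hd : d = 2 ∨ d = 3)
    (Ω : Set (CompressibleStokes.Rd d)) (hΩ : CompressibleStokes.IsLipschitzDomain Ω)
    (𝒯 : CompressibleStokes.Triangulation Ω) (k : ℕ) (hk : 1 ≤ k)
    (ν α cM M : ℝ) (hν : 0 < ν) (hα : 0 < α) (hcM : 0 < cM) (hM : 0 < M) :
    𝒯.GradientRobust k ν α cM M ∧
    ∀ (q : CompressibleStokes.Rd d → ℝ)
      (f : CompressibleStokes.Rd d → CompressibleStokes.Rd d),
      CompressibleStokes.IsH1WithGradient Ω q f →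
      CompressibleStokes.IsAdmissiblePotential Ω cM M q →
      ∃ (π : 𝒯.Scalar) (κ : ℝ),
        𝒯.IsL2Projection k q π ∧
        κ = (M - (∫ x in Ω, q x) / cM) / MeasureTheory.volume.real Ω ∧
        𝒯.IsDiscreteSolution k ν α cM M 0 f 0 0
          (CompressibleStokes.Triangulation.hydrostaticDensity cM κ π) ∧
        (k = 1 → ∀ T, ∀ x ∈ CompressibleStokes.hull T.1,
          0 ≤ CompressibleStokes.pval
            (CompressibleStokes.Triangulation.hydrostaticDensity cM κ π T) x) ∧
        (k = 1 → (∀ᵐ x ∂(CompressibleStokes.vol Ω), 0 < q x / cM + κ) →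
          ∀ T, ∀ x ∈ CompressibleStokes.hull T.1,
            0 < CompressibleStokes.pval
              (CompressibleStokes.Triangulation.hydrostaticDensity cM κ π T) x) := by
  have key : ∀ (q : CompressibleStokes.Rd d → ℝ)
      (f : CompressibleStokes.Rd d → CompressibleStokes.Rd d),
      CompressibleStokes.IsH1WithGradient Ω q f →
      ∃ π : 𝒯.Scalar, 𝒯.IsL2Projection k q π ∧
        𝒯.IsDiscreteSolution k ν α cM M 0 f 0 0
          (CompressibleStokes.Triangulation.hydrostaticDensity cM
            ((M - (∫ x in Ω, q x) / cM) / MeasureTheory.volume.real Ω) π) := by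
    intro q f hq
    obtain ⟨π, hπ⟩ := 𝒯.exists_isL2Projection hΩ.isBounded k hq.memLp
    exact ⟨π, hπ, CompressibleStokes.Triangulation.isDiscreteSolution_hydrostatic hΩ k ν α
      hcM.ne' M hq hπ⟩
  refine ⟨?_, ?_⟩
  · rintro f ⟨q, hq, -⟩
    obtain ⟨π, -, hsol⟩ := key q f hq
    exact ⟨_, hsol⟩
  · intro q f hq hadm
    obtain ⟨π, hπ, hsol⟩ := key q f hq
    refine ⟨π, _, hπ, rfl, hsol, ?_, ?_⟩
    · rintro rfl T x -
      exact CompressibleStokes.Triangulation.hydrostaticDensity_nonneg hΩ hq.memLp hπ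
        (hadm.ae_nonneg hΩ hq.memLp) T x
    · rintro rfl hpos T x -
      exact CompressibleStokes.Triangulation.hydrostaticDensity_pos hΩ hq.memLp hπ hpos T x
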